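/- Let $\alpha_0,\alpha_1,\alpha_2,\alpha_3\in\mathbb{C}$ satisfy $\alpha_0+\alpha_1+2\alpha_2+\alpha_3=1/2$, and consider the Sasano system of type $A_5^{(2)}$, with $'=d/dt$, \begin{align*} tq_1' &=2q_1^2p_1-q_1^2+(\alpha_0+\alpha_1+\alpha_3)q_1-t+4tp_2+2q_1q_2p_2,\\ tp_1' &=-2q_1p_1^2+2q_1p_1-(\alpha_0+\alpha_1+\alpha_3)p_1+\alpha_0-2p_1q_2p_2,\\ tq_2' &=2q_2^2p_2-q_2^2+(\alpha_0+\alpha_1+\alpha_3)q_2-t+4tp_1+2q_1p_1q_2,\\ tp_2' &=-2q_2p_2^2+2q_2p_2-(\alpha_0+\alpha_1+\alpha_3)p_2+\alpha_1-2q_1p_1p_2. \end{align*} The system has exactly one formal solution $(q_1,p_1,q_2,p_2)$ in Laurent series in $t^{-1}$ (with at most finitely many positive powers of $t$). This solution contains no positive powers of $t$, and it begins \begin{align*} q_1&=(-2\alpha_0+\alpha_3)+\cdots, & p_1&=\tfrac14+\tfrac14(-2\alpha_1+\alpha_3)(-2\alpha_1-\alpha_3)\,t^{-1}+\cdots,\\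 q_2&=(-2\alpha_1+\alpha_3)+\cdots, & p_2&=\tfrac14+\tfrac14(-2\alpha_0+\alpha_3)(-2\alpha_0-\alpha_3)\,t^{-1}+\cdots. \end{align*} Moreover, let $(q_1,p_1,q_2,p_2)$ be any solution on a punctured neighbourhood of $t=\infty$ whose four components are meromorphic at $t=\infty$. Then all four components are holomorphic at $t=\infty$, and their convergent expansions in powers of $t^{-1}$ near $t=\infty$ are the series of that formal solution. In particular the expansions are unique: they depend only on the parameters. -/

import Mathlib

open Filter Topology

/-- The four equations of the Sasano system of type `A₅⁽²⁾` with parameters `α₀, α₁, α₃`, as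
relations in a commutative ring between the values `q₁, p₁, q₂, p₂`, the independent variable `t`
and the values `θq₁, θp₁, θq₂, θp₂` of `t * d/dt` applied to the unknowns. -/
structure SasanoEqs {R : Type*} [CommRing R] (α₀ α₁ α₃ t q₁ p₁ q₂ p₂ θq₁ θp₁ θq₂ θp₂ : R) :
    Prop where
  eq_q₁ : θq₁ = 2 * q₁ ^ 2 * p₁ - q₁ ^ 2 + (α₀ + α₁ + α₃) * q₁ - t + 4 * t * p₂ + 2 * q₁ * q₂ * p₂
  eq_p₁ : θp₁ = -2 * q₁ * p₁ ^ 2 + 2 * q₁ * p₁ - (α₀ + α₁ + α₃) * p₁ + α₀ - 2 * p₁ * q₂ * p₂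
  eq_q₂ : θq₂ = 2 * q₂ ^ 2 * p₂ - q₂ ^ 2 + (α₀ + α₁ + α₃) * q₂ - t + 4 * t * p₁ + 2 * q₁ * p₁ * q₂
  eq_p₂ : θp₂ = -2 * q₂ * p₂ ^ 2 + 2 * q₂ * p₂ - (α₀ + α₁ + α₃) * p₂ + α₁ - 2 * q₁ * p₁ * p₂

/-- `(q₁, p₁, q₂, p₂)` are differentiable and solve the Sasano system at all complex `t` of
sufficiently large modulus. -/
def IsSolutionNearInfty (α₀ α₁ α₃ : ℂ) (q₁ p₁ q₂ p₂ : ℂ → ℂ) : Prop :=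
  ∀ᶠ t in Bornology.cobounded ℂ,
    DifferentiableAt ℂ q₁ t ∧ DifferentiableAt ℂ p₁ t ∧
    DifferentiableAt ℂ q₂ t ∧ DifferentiableAt ℂ p₂ t ∧
    SasanoEqs α₀ α₁ α₃ t (q₁ t) (p₁ t) (q₂ t) (p₂ t)
      (t * deriv q₁ t) (t * deriv p₁ t) (t * deriv q₂ t) (t * deriv p₂ t)

/-- `f` is meromorphic at `t = ∞` (a pole or a removable singularity in `s = 1 / t` at `s = 0`;
the value of `f` at a single finite point plays no role). -/
def MeromorphicAtInfty (f : ℂ → ℂ) : Prop :=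
  MeromorphicAt (fun s : ℂ => f s⁻¹) 0

/-- `f` is holomorphic at `t = ∞`: for `t` near `∞` it is an analytic function of `1 / t`. -/
def HolomorphicAtInfty (f : ℂ → ℂ) : Prop :=
  ∃ g : ℂ → ℂ, AnalyticAt ℂ g 0 ∧ ∀ᶠ t in Bornology.cobounded ℂ, f t = g t⁻¹

/-- For all `t` near `∞`, `f t` is the sum of the convergent series `∑ n, Fₙ t⁻ⁿ`. -/
def HasExpansionAtInfty (f : ℂ → ℂ) (F : PowerSeries ℂ) : Prop :=
  ∀ᶠ t in Bornology.cobounded ℂ, HasSum (fun n : ℕ => PowerSeries.coeff n F * t⁻¹ ^ n) (f t)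

/-- The operator `t * d/dt` on formal Laurent series in `X = t⁻¹`, that is, `-X * d/dX`. -/
noncomputable def thetaInfty (F : LaurentSeries ℂ) : LaurentSeries ℂ :=
  -(HahnSeries.single (1 : ℤ) (1 : ℂ) * LaurentSeries.derivative ℂ F)

/-- A formal Laurent series solution at `t = ∞` of the Sasano system. Laurent series are in
`X = t⁻¹`, with finitely many terms of positive degree in `t`; the variable `t` is `X⁻¹`. -/
def IsFormalSolutionAtInfty (α₀ α₁ α₃ : ℂ) (q₁ p₁ q₂ p₂ : LaurentSeries ℂ) : Prop :=
  SasanoEqs (HahnSeries.C α₀ : LaurentSeries ℂ) (HahnSeries.C α₁) (HahnSeries.C α₃)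
    (HahnSeries.single (-1 : ℤ) (1 : ℂ)) q₁ p₁ q₂ p₂
    (thetaInfty q₁) (thetaInfty p₁) (thetaInfty q₂) (thetaInfty p₂)

/-! ### The order of a Laurent series -/

/-! Put `X = t⁻¹`, `θ = t d/dt`, `a = α₀ + α₁ + α₃` and `w = 2(q₁p₁ + q₂p₂) + a`. The system becomes
`θq₁ + q₁(q₁ - w) = t(4p₂ - 1)` and `p₁(2q₁ - w) = θp₁ - α₀`, together with the same two equations
under exchange of the indices and of `α₀`, `α₁`. Adding the two `p` equations gives `w(1 - p₁ - p₂)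
= α₃ - θ(1 - p₁ - p₂)`.

Poles are excluded by parity (`IsFormalSolutionAtInfty.ordGE`). If `w` has a pole of order `m` in
`t`, then `p₁ + p₂ → 1`, both `pᵢ` stay away from order `≥ 1` in `X`, and `qᵢ` equals `w/2` up to a
series without pole. The sum of the two `q` equations then has a left side of even order `2m` in `t`
and a right side of order exactly 1. If `w` has no pole, the same parity argument forbids `p₂` from
vanishing at infinity; then `q₁`, `q₂` have no pole and `p₁, p₂ → 1/4`.

It remains to solve for power series. With `pᵢ = (1 + X Vᵢ)/4` the `p` equations have the invertible
linear part `(3Q₁ - Q₂, 3Q₂ - Q₁)` modulo `X`, and the `q` equations give `V₂`, `V₁` explicitly.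
Every coefficient is thus determined by earlier ones without resonance: a contraction for the
`X`-adic topology (`exists_reducedSasanoEqs_unique`).

Finally, the Laurent expansions of a meromorphic solution form a formal solution, hence are those
power series, and they converge because they expand meromorphic germs. -/

theorem thetaInfty_coeff (F : LaurentSeries ℂ) (k : ℤ) :
    (thetaInfty F).coeff k = -(k * F.coeff k) := by
  have h := HahnSeries.coeff_single_mul_add (r := (1 : ℂ)) (x := LaurentSeries.derivative ℂ F)
    (a := k - 1) (b := (1 : ℤ))
  rw [sub_add_cancel, one_mul] at h
  rw [thetaInfty, HahnSeries.coeff_neg, h]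
  simp [LaurentSeries.derivative_apply, LaurentSeries.hasseDeriv_coeff]

/-- The Laurent series `x` has order at least `n` in `X`. -/
def OrdGE (n : ℤ) (x : LaurentSeries ℂ) : Prop := (n : WithTop ℤ) ≤ x.orderTop

/-- The Laurent series `x` is nonzero, of order exactly `n` in `X`. -/
def OrdEq (n : ℤ) (x : LaurentSeries ℂ) : Prop := x.orderTop = (n : WithTop ℤ)

theorem ordGE_iff {n : ℤ} {x : LaurentSeries ℂ} : OrdGE n x ↔ ∀ k < n, x.coeff k = 0 := by
  simp [OrdGE, HahnSeries.le_orderTop_iff_forall]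

theorem OrdGE.mono {m n : ℤ} {x : LaurentSeries ℂ} (h : OrdGE n x) (hmn : m ≤ n) : OrdGE m x :=
  (WithTop.coe_le_coe.2 hmn).trans h

theorem OrdGE.add {n : ℤ} {x y : LaurentSeries ℂ} (hx : OrdGE n x) (hy : OrdGE n y) :
    OrdGE n (x + y) :=
  (le_min hx hy).trans HahnSeries.min_orderTop_le_orderTop_add

theorem OrdGE.neg {n : ℤ} {x : LaurentSeries ℂ} (hx : OrdGE n x) : OrdGE n (-x) := by
  unfold OrdGE at *
  rwa [HahnSeries.orderTop_neg]

theorem OrdGE.sub {n : ℤ} {x y : LaurentSeries ℂ} (hx : OrdGE n x) (hy : OrdGE n y) :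
    OrdGE n (x - y) :=
  sub_eq_add_neg x y ▸ hx.add hy.neg

theorem OrdGE.mul {m n : ℤ} {x y : LaurentSeries ℂ} (hx : OrdGE m x) (hy : OrdGE n y) :
    OrdGE (m + n) (x * y) := by
  unfold OrdGE at *
  rw [HahnSeries.orderTop_mul, WithTop.coe_add]
  exact add_le_add hx hy

theorem OrdGE.theta {n : ℤ} {x : LaurentSeries ℂ} (hx : OrdGE n x) : OrdGE n (thetaInfty x) := by
  rw [ordGE_iff] at *
  intro k hk
  rw [thetaInfty_coeff, hx k hk, mul_zero, neg_zero]

theorem ordGE_C (c : ℂ) : OrdGE 0 (HahnSeries.C c) := HahnSeries.orderTop_single_le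

theorem ordEq_C {c : ℂ} (hc : c ≠ 0) : OrdEq 0 (HahnSeries.C c) := HahnSeries.orderTop_single hc

theorem ordEq_ofNat (n : ℕ) [n.AtLeastTwo] : OrdEq 0 (OfNat.ofNat n : LaurentSeries ℂ) := by
  rw [← map_ofNat HahnSeries.C n]
  exact ordEq_C (OfNat.ofNat_ne_zero n)

theorem ordEq_one : OrdEq 0 (1 : LaurentSeries ℂ) := ordEq_C one_ne_zero

theorem OrdEq.ordGE {n : ℤ} {x : LaurentSeries ℂ} (h : OrdEq n x) : OrdGE n x := h.ge

theorem OrdEq.le {m n : ℤ} {x : LaurentSeries ℂ} (h : OrdEq n x) (h' : OrdGE m x) : m ≤ n :=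
  WithTop.coe_le_coe.1 (h ▸ h')

theorem OrdEq.unique {m n : ℤ} {x : LaurentSeries ℂ} (h : OrdEq n x) (h' : OrdEq m x) : m = n :=
  le_antisymm (h.le h'.ordGE) (h'.le h.ordGE)

theorem OrdEq.mul {m n : ℤ} {x y : LaurentSeries ℂ} (hx : OrdEq m x) (hy : OrdEq n y) :
    OrdEq (m + n) (x * y) := by
  unfold OrdEq at *
  rw [HahnSeries.orderTop_mul, hx, hy, WithTop.coe_add]

theorem OrdEq.add {m n : ℤ} {x y : LaurentSeries ℂ} (hx : OrdEq m x) (hy : OrdGE n y)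
    (hmn : m < n) : OrdEq m (x + y) := by
  unfold OrdEq at *
  rw [HahnSeries.orderTop_add_eq_left, hx]
  exact (hx ▸ WithTop.coe_lt_coe.2 hmn).trans_le hy

theorem eq_zero_or_exists_ordEq (x : LaurentSeries ℂ) : x = 0 ∨ ∃ n, OrdEq n x := by
  by_cases h : x = 0
  · exact .inl h
  · exact .inr ⟨x.order, HahnSeries.order_eq_orderTop_of_ne_zero h |>.symm⟩

theorem OrdGE.zero (n : ℤ) : OrdGE n 0 := by simp [OrdGE]

theorem exists_ordEq_of_not_ordGE {n : ℤ} {x : LaurentSeries ℂ} (h : ¬ OrdGE n x) :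
    ∃ k < n, OrdEq k x := by
  obtain rfl | ⟨k, hk⟩ := eq_zero_or_exists_ordEq x
  · exact absurd (OrdGE.zero n) h
  · refine ⟨k, ?_, hk⟩
    by_contra! hn
    exact h (hk.ordGE.mono hn)

theorem OrdEq.ordGE_of_mul {k n : ℤ} {x y : LaurentSeries ℂ} (hx : OrdEq k x)
    (h : OrdGE n (x * y)) : OrdGE (n - k) y := by
  obtain rfl | ⟨j, hj⟩ := eq_zero_or_exists_ordEq y
  · exact OrdGE.zero _
  · have := (hx.mul hj).le h
    exact hj.ordGE.mono (by lia)

theorem thetaInfty_add (x y : LaurentSeries ℂ) :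
    thetaInfty (x + y) = thetaInfty x + thetaInfty y := by
  ext k
  simp only [HahnSeries.coeff_add, thetaInfty_coeff]
  ring

theorem thetaInfty_sub (x y : LaurentSeries ℂ) :
    thetaInfty (x - y) = thetaInfty x - thetaInfty y := by
  ext k
  simp only [HahnSeries.coeff_sub, thetaInfty_coeff]
  ring

theorem thetaInfty_C (c : ℂ) : thetaInfty (HahnSeries.C c) = 0 := by
  ext k
  rw [thetaInfty_coeff]
  by_cases hk : k = 0 <;> simp [hk, HahnSeries.C_apply, HahnSeries.coeff_single_of_ne]

/-! ### Absence of poles -/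

/-- A pole of `q` makes `q ^ 2` dominate, so the order is even; without a pole in `q` the order is
nonnegative. -/
theorem OrdEq.not_add_eq_ordEq_odd {q w : LaurentSeries ℂ} {n : ℤ} (hn : n < 0) (hodd : Odd n)
    (hw : OrdGE 0 w) : ¬ OrdEq n (thetaInfty q + q * (q - w)) := by
  intro h
  by_cases hq : OrdGE 0 q
  · have := h.le (hq.theta.add (hq.mul (hq.sub hw)))
    lia
  · obtain ⟨k, hk, hqk⟩ := exists_ordEq_of_not_ordGE hq
    have h1 : OrdEq (k + k) (q * q + (thetaInfty q - q * w)) :=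
      (hqk.mul hqk).add (n := k) (hqk.ordGE.theta.sub ((hqk.ordGE.mul hw).mono (by lia))) (by lia)
    rw [show q * q + (thetaInfty q - q * w) = thetaInfty q + q * (q - w) by ring] at h1
    have := h.unique h1
    obtain ⟨m, hm⟩ := hodd
    lia

/-- If `p` has order `k ≤ 0`, the right side has order at least `k`, since `θ` does not lower the
order; division by `p` leaves order at least 0. -/
theorem ordGE_of_mul_eq_theta_sub {a : ℂ} {p x : LaurentSeries ℂ} (hp : ¬ OrdGE 1 p)
    (h : p * x = thetaInfty p - HahnSeries.C a) : OrdGE 0 x := by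
  obtain ⟨k, hk, hpk⟩ := exists_ordEq_of_not_ordGE hp
  have h1 : OrdGE k (p * x) := h ▸ hpk.ordGE.theta.sub ((ordGE_C a).mono (by lia))
  simpa using hpk.ordGE_of_mul h1

theorem OrdGE.of_two_mul_sub {q w : LaurentSeries ℂ} {n : ℤ} (hw : OrdGE n w)
    (h : OrdGE n (2 * q - w)) : OrdGE n q := by
  have h1 : OrdGE n (2 * q) := by simpa using h.add hw
  simpa using (ordEq_ofNat 2).ordGE_of_mul h1

/-- If `w` has a pole and `2 * q - w` has none, then `q * (q - w)` behaves like `-w ^ 2 / 4`. -/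
theorem exists_theta_add_eq_of_pole {q w : LaurentSeries ℂ} {d : ℤ} (hd : d < 0) (hw : OrdEq d w)
    (h : OrdGE 0 (2 * q - w)) :
    ∃ r, OrdGE d r ∧ 4 * (thetaInfty q + q * (q - w)) = r - w * w := by
  have hq : OrdGE d q := hw.ordGE.of_two_mul_sub (h.mono hd.le)
  refine ⟨4 * thetaInfty q + (2 * q - w) * (2 * q - w), ?_, by ring⟩
  exact (((ordEq_ofNat 4).ordGE.mul hq.theta).mono (by lia)).add ((h.mul h).mono (by lia))

theorem ordEq_single_neg_one : OrdEq (-1) (HahnSeries.single (-1 : ℤ) (1 : ℂ)) :=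
  HahnSeries.orderTop_single one_ne_zero

/-- The left side of `hq` behaves like `-w ^ 2 / 4`, of order `2d ≤ -2`, whereas vanishing of `p` at
infinity would leave order at least `-1` on the right. -/
theorem not_ordGE_one_of_pole {q w p t : LaurentSeries ℂ} {d : ℤ} (hd : d < 0) (hw : OrdEq d w)
    (h : OrdGE 0 (2 * q - w)) (ht : OrdEq (-1) t)
    (hq : thetaInfty q + q * (q - w) = t * (4 * p - 1)) : ¬ OrdGE 1 p := by
  intro hp
  obtain ⟨r, hr, hr'⟩ := exists_theta_add_eq_of_pole hd hw h
  have h1 : OrdEq (d + d) (4 * (thetaInfty q + q * (q - w))) := by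
    have := (hw.mul hw).add hr.neg (by lia)
    rw [hr']
    unfold OrdEq at *
    rw [← HahnSeries.orderTop_neg, ← this]
    congr 1
    ring
  rw [hq] at h1
  have h2 : OrdGE (-1) (4 * (t * (4 * p - 1))) := by
    refine ((ordEq_ofNat 4).ordGE.mul (ht.ordGE.mul (n := 0) (OrdGE.sub ?_ ordEq_one.ordGE))).mono
      (by lia)
    exact ((ordEq_ofNat 4).ordGE.mul hp).mono (by lia)
  have := h1.le h2
  lia

theorem ordEq_one_sub {p : LaurentSeries ℂ} (hp : OrdGE 1 p) : OrdEq 0 (4 * p - 1) := by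
  have h := ordEq_one.add ((ordEq_ofNat 4).ordGE.mul hp).neg (by lia)
  unfold OrdEq at *
  rw [← HahnSeries.orderTop_neg, ← h]
  congr 1
  ring

theorem ordGE_of_four_mul {t p x : LaurentSeries ℂ} (ht : OrdEq (-1) t) (hx : OrdGE 0 x)
    (h : x = t * (4 * p - 1)) : OrdGE 1 (4 * p - 1) := by
  exact (ht.ordGE_of_mul (h ▸ hx)).mono (by lia)

theorem not_ordGE_one_of_four_mul {p : LaurentSeries ℂ} (h : OrdGE 1 (4 * p - 1)) :
    ¬ OrdGE 1 p := by
  intro hp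
  have := (ordEq_one_sub hp).le h
  lia

/-- A formal solution at infinity has no positive powers of `t`, and `p₁`, `p₂` tend to `1 / 4`. -/
theorem IsFormalSolutionAtInfty.ordGE {α₀ α₁ α₃ : ℂ} {q₁ p₁ q₂ p₂ : LaurentSeries ℂ}
    (h : IsFormalSolutionAtInfty α₀ α₁ α₃ q₁ p₁ q₂ p₂) :
    OrdGE 0 q₁ ∧ OrdGE 1 (4 * p₁ - 1) ∧ OrdGE 0 q₂ ∧ OrdGE 1 (4 * p₂ - 1) := by
  obtain ⟨e1, e2, e3, e4⟩ := h
  have ht := ordEq_single_neg_one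
  set t : LaurentSeries ℂ := HahnSeries.single (-1 : ℤ) (1 : ℂ)
  -- All coupling between the index pairs, apart from the terms in `t`, is absorbed into `w`.
  set w := 2 * (q₁ * p₁ + q₂ * p₂) + (HahnSeries.C α₀ + HahnSeries.C α₁ + HahnSeries.C α₃) with hw
  have f1 : thetaInfty q₁ + q₁ * (q₁ - w) = t * (4 * p₂ - 1) := by rw [e1, hw]; ring
  have f2 : p₁ * (2 * q₁ - w) = thetaInfty p₁ - HahnSeries.C α₀ := by rw [e2, hw]; ring
  have f3 : thetaInfty q₂ + q₂ * (q₂ - w) = t * (4 * p₁ - 1) := by rw [e3, hw]; ring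
  have f4 : p₂ * (2 * q₂ - w) = thetaInfty p₂ - HahnSeries.C α₁ := by rw [e4, hw]; ring
  have f5 : w * (1 - p₁ - p₂) = HahnSeries.C α₃ - thetaInfty (1 - p₁ - p₂) := by
    have h1 : thetaInfty (1 : LaurentSeries ℂ) = 0 := thetaInfty_C 1
    rw [thetaInfty_sub, thetaInfty_sub, h1]
    linear_combination f2 + f4 + hw
  clear_value w
  by_cases hw0 : OrdGE 0 w
  · have g1 : ¬ OrdGE 1 p₁ → OrdGE 0 q₁ ∧ OrdGE 1 (4 * p₂ - 1) := fun hp => by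
      have hq := hw0.of_two_mul_sub (ordGE_of_mul_eq_theta_sub hp f2)
      exact ⟨hq, ordGE_of_four_mul ht (hq.theta.add (hq.mul (hq.sub hw0))) f1⟩
    have g2 : ¬ OrdGE 1 p₂ → OrdGE 0 q₂ ∧ OrdGE 1 (4 * p₁ - 1) := fun hp => by
      have hq := hw0.of_two_mul_sub (ordGE_of_mul_eq_theta_sub hp f4)
      exact ⟨hq, ordGE_of_four_mul ht (hq.theta.add (hq.mul (hq.sub hw0))) f3⟩
    by_cases hp : OrdGE 1 p₂
    · have h1 := ht.mul (ordEq_one_sub hp)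
      rw [← f1] at h1
      exact absurd h1 (OrdEq.not_add_eq_ordEq_odd (by lia) (by decide) hw0)
    · obtain ⟨hq₂, hp₁⟩ := g2 hp
      obtain ⟨hq₁, hp₂⟩ := g1 (not_ordGE_one_of_four_mul hp₁)
      exact ⟨hq₁, hp₁, hq₂, hp₂⟩
  · exfalso
    obtain ⟨d, hd, hwd⟩ := exists_ordEq_of_not_ordGE hw0
    have hP : OrdGE 1 (1 - p₁ - p₂) := by
      obtain h0 | ⟨k, hk⟩ := eq_zero_or_exists_ordEq (1 - p₁ - p₂)
      · rw [h0]
        exact OrdGE.zero 1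
      -- As `w` has a pole, `w * P` dominates `θP` for `P = 1 - p₁ - p₂`; their sum is the constant
      -- `α₃`, so `d + k ≥ 0`.
      · have h1 := (hwd.mul hk).add hk.ordGE.theta (by lia)
        rw [f5, sub_add_cancel] at h1
        have := h1.le (ordGE_C α₃)
        exact hk.ordGE.mono (by lia)
    have hp : ¬ OrdGE 1 p₁ ∧ ¬ OrdGE 1 p₂ := by
      have g1 : ¬ OrdGE 1 p₁ → ¬ OrdGE 1 p₂ := fun hp =>
        not_ordGE_one_of_pole hd hwd (ordGE_of_mul_eq_theta_sub hp f2) ht f1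
      have g2 : ¬ OrdGE 1 p₂ → ¬ OrdGE 1 p₁ := fun hp =>
        not_ordGE_one_of_pole hd hwd (ordGE_of_mul_eq_theta_sub hp f4) ht f3
      -- By `g1` and `g2` one of the `pᵢ` vanishes at infinity only if both do, against `p₁ + p₂ →
      -- 1`.
      by_contra hcon
      have h1 : OrdGE 1 p₁ := by tauto
      have h2 : OrdGE 1 p₂ := by tauto
      have h3 := (hP.add h1).add h2
      rw [show 1 - p₁ - p₂ + p₁ + p₂ = 1 by ring] at h3
      have := ordEq_one.le h3
      lia
    obtain ⟨r₁, hr₁, hr₁'⟩ :=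
      exists_theta_add_eq_of_pole hd hwd (ordGE_of_mul_eq_theta_sub hp.1 f2)
    obtain ⟨r₂, hr₂, hr₂'⟩ :=
      exists_theta_add_eq_of_pole hd hwd (ordGE_of_mul_eq_theta_sub hp.2 f4)
    have h1 : OrdEq (d + d) (w * w * 2 + -(r₁ + r₂)) := by
      refine OrdEq.add (n := d) ?_ (hr₁.add hr₂).neg (by lia)
      simpa using (hwd.mul hwd).mul (ordEq_ofNat 2)
    have h2 : OrdEq (-1) (4 * (t * (-2 + 4 * (1 - p₁ - p₂)))) := by
      have h3 : OrdEq 0 (-2 : LaurentSeries ℂ) := by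
        have := ordEq_ofNat 2
        unfold OrdEq at *
        rwa [HahnSeries.orderTop_neg]
      simpa using (ordEq_ofNat 4).mul
        (ht.mul (h3.add ((ordEq_ofNat 4).ordGE.mul hP) (by lia)))
    -- Four times the sum of `f1` and `f3`: even order `d + d` on the left, order `-1` on the right.
    have h3 : w * w * 2 + -(r₁ + r₂) = 4 * (t * (-2 + 4 * (1 - p₁ - p₂))) := by
      linear_combination hr₁' + hr₂' - 4 * f1 - 4 * f3
    have := h1.unique (h3 ▸ h2)
    lia

/-! ### Fixed points of contractions of formal power series -/

/-- The power series `F` and `G` agree in all degrees below `n`. -/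
def EqUpTo (n : ℕ) (F G : PowerSeries ℂ) : Prop :=
  ∀ k < n, PowerSeries.coeff k F = PowerSeries.coeff k G

theorem EqUpTo.refl (n : ℕ) (F : PowerSeries ℂ) : EqUpTo n F F := fun _ _ => rfl

theorem EqUpTo.add {n : ℕ} {F G F' G' : PowerSeries ℂ} (h : EqUpTo n F G) (h' : EqUpTo n F' G') :
    EqUpTo n (F + F') (G + G') := fun k hk => by
  rw [map_add, map_add, h k hk, h' k hk]

theorem EqUpTo.sub {n : ℕ} {F G F' G' : PowerSeries ℂ} (h : EqUpTo n F G) (h' : EqUpTo n F' G') :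
    EqUpTo n (F - F') (G - G') := fun k hk => by
  rw [map_sub, map_sub, h k hk, h' k hk]

theorem EqUpTo.mul {n : ℕ} {F G F' G' : PowerSeries ℂ} (h : EqUpTo n F G) (h' : EqUpTo n F' G') :
    EqUpTo n (F * F') (G * G') := fun k hk => by
  rw [PowerSeries.coeff_mul, PowerSeries.coeff_mul]
  refine Finset.sum_congr rfl fun x hx => ?_
  have := Finset.HasAntidiagonal.mem_antidiagonal.1 hx
  rw [h _ (by lia), h' _ (by lia)]

theorem EqUpTo.pow {n : ℕ} {F G : PowerSeries ℂ} (h : EqUpTo n F G) :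
    EqUpTo n (F ^ 2) (G ^ 2) := by
  rw [pow_two, pow_two]
  exact h.mul h

theorem EqUpTo.X_mul {n : ℕ} {F G : PowerSeries ℂ} (h : EqUpTo n F G) :
    EqUpTo (n + 1) (PowerSeries.X * F) (PowerSeries.X * G) := fun k hk => by
  cases k with
  | zero => simp
  | succ k => rw [PowerSeries.coeff_succ_X_mul, PowerSeries.coeff_succ_X_mul, h k (by lia)]

/-- A map on tuples of power series that improves agreement by one degree has exactly one fixed
point. -/
theorem existsUnique_fixedPoint_of_contracting {ι : Type*}
    (T : (ι → PowerSeries ℂ) → ι → PowerSeries ℂ)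
    (hT : ∀ n F G, (∀ i, EqUpTo n (F i) (G i)) → ∀ i, EqUpTo (n + 1) (T F i) (T G i)) :
    ∃! F, T F = F := by
  set a : ℕ → ι → PowerSeries ℂ := fun n => T^[n] 0 with ha
  have hsucc : ∀ n, a (n + 1) = T (a n) := fun n => Function.iterate_succ_apply' T n 0
  have hstep : ∀ n i, EqUpTo n (a n i) (a (n + 1) i) := by
    intro n
    induction n with
    | zero => exact fun i k hk => absurd hk (Nat.not_lt_zero k)
    | succ n ih =>
      rw [hsucc (n + 1), hsucc n]
      exact hT n _ _ (hsucc n ▸ ih)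
  have hlim : ∀ n m i, EqUpTo n (a n i) (a (n + m) i) := by
    intro n m i
    induction m with
    | zero => exact EqUpTo.refl _ _
    | succ m ih => exact fun k hk => (ih k hk).trans (hstep (n + m) i k (by lia))
  -- The iterate `a n` is final only in degrees below `n`, so coefficient `k` is read from `a (k +
  -- 1)`.
  refine ⟨fun i => PowerSeries.mk fun k => PowerSeries.coeff k (a (k + 1) i), ?_, ?_⟩
  · have hF : ∀ n i, EqUpTo n
        (PowerSeries.mk fun k => PowerSeries.coeff k (a (k + 1) i)) (a n i) := by
      intro n i k hk
      obtain ⟨m, rfl⟩ := Nat.exists_eq_add_of_le (show k + 1 ≤ n from hk)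
      rw [PowerSeries.coeff_mk]
      exact hlim (k + 1) m i k (by lia)
    funext i
    ext k
    rw [hT k _ _ (hF k) i k (by lia), ← hsucc, PowerSeries.coeff_mk]
  · intro G hG
    have hGa : ∀ n i, EqUpTo n (G i) (a n i) := by
      intro n
      induction n with
      | zero => exact fun i k hk => absurd hk (Nat.not_lt_zero k)
      | succ n ih =>
        have h := hT n G (a n) ih
        rwa [hG, ← hsucc n] at h
    funext i
    ext k
    rw [PowerSeries.coeff_mk]
    exact hGa (k + 1) i k (by lia)

/-! ### The system for the Taylor coefficients at infinity -/

/-- The operator `-X * d/dX` on power series. -/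
noncomputable def powerTheta (F : PowerSeries ℂ) : PowerSeries ℂ :=
  PowerSeries.mk fun n => -(n * PowerSeries.coeff n F)

theorem EqUpTo.theta {n : ℕ} {F G : PowerSeries ℂ} (h : EqUpTo n F G) :
    EqUpTo n (powerTheta F) (powerTheta G) := fun k hk => by
  rw [powerTheta, powerTheta, PowerSeries.coeff_mk, PowerSeries.coeff_mk, h k hk]

theorem thetaInfty_ofPowerSeries (F : PowerSeries ℂ) :
    thetaInfty (HahnSeries.ofPowerSeries ℤ ℂ F) = HahnSeries.ofPowerSeries ℤ ℂ (powerTheta F) := by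
  ext k
  rw [thetaInfty_coeff, PowerSeries.coeff_coe, PowerSeries.coeff_coe]
  split_ifs with hk
  · simp
  · rw [powerTheta, PowerSeries.coeff_mk]
    have : (k : ℂ) = (k.natAbs : ℂ) := by
      obtain ⟨n, rfl⟩ := Int.eq_ofNat_of_zero_le (not_lt.1 hk)
      simp
    rw [this]

theorem powerTheta_one_add_X_mul (V : PowerSeries ℂ) :
    powerTheta (1 + PowerSeries.X * V) = PowerSeries.X * (powerTheta V - V) := by
  ext k
  rw [powerTheta, PowerSeries.coeff_mk]
  cases k with
  | zero => simp
  | succ k =>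
    rw [map_add, PowerSeries.coeff_succ_X_mul, PowerSeries.coeff_succ_X_mul, map_sub, powerTheta,
      PowerSeries.coeff_mk, PowerSeries.coeff_one, if_neg k.succ_ne_zero]
    push_cast
    ring

/-- The part divisible by `X` of the equation for `p = (1 + X * V) / 4`. -/
def reducedRemainder {R : Type*} [CommRing R] (a X Q V Q' V' θV : R) : R :=
  Q * (2 * V - X * V ^ 2) - Q' * (V + V' + X * V * V') - 2 * a * V - 2 * (θV - V)

/-- The Sasano system in the unknowns `q₁, V₁, q₂, V₂`, where `pᵢ = (1 + X * Vᵢ) / 4` and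
`X = t⁻¹`. -/
structure ReducedSasanoEqs {R : Type*} [CommRing R]
    (α₀ α₁ α₃ X Q₁ V₁ Q₂ V₂ θQ₁ θV₁ θQ₂ θV₂ : R) : Prop where
  eq_V₁ : 3 * Q₁ - Q₂ - 2 * (α₀ + α₁ + α₃) + 8 * α₀ +
    X * reducedRemainder (α₀ + α₁ + α₃) X Q₁ V₁ Q₂ V₂ θV₁ = 0
  eq_V₂ : 3 * Q₂ - Q₁ - 2 * (α₀ + α₁ + α₃) + 8 * α₁ +
    X * reducedRemainder (α₀ + α₁ + α₃) X Q₂ V₂ Q₁ V₁ θV₂ = 0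
  eq_Q₁ : 2 * θQ₁ = Q₁ ^ 2 * (1 + X * V₁) - 2 * Q₁ ^ 2 + 2 * (α₀ + α₁ + α₃) * Q₁ + 2 * V₂ +
    Q₁ * Q₂ * (1 + X * V₂)
  eq_Q₂ : 2 * θQ₂ = Q₂ ^ 2 * (1 + X * V₂) - 2 * Q₂ ^ 2 + 2 * (α₀ + α₁ + α₃) * Q₂ + 2 * V₁ +
    Q₂ * Q₁ * (1 + X * V₁)

theorem reducedSasanoEqs_map_iff {R S : Type*} [CommRing R] [CommRing S] (f : R →+* S)
    (hf : Function.Injective f) (α₀ α₁ α₃ X Q₁ V₁ Q₂ V₂ θQ₁ θV₁ θQ₂ θV₂ : R) :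
    ReducedSasanoEqs (f α₀) (f α₁) (f α₃) (f X) (f Q₁) (f V₁) (f Q₂) (f V₂)
        (f θQ₁) (f θV₁) (f θQ₂) (f θV₂) ↔
      ReducedSasanoEqs α₀ α₁ α₃ X Q₁ V₁ Q₂ V₂ θQ₁ θV₁ θQ₂ θV₂ := by
  constructor
  · rintro ⟨h1, h2, h3, h4⟩
    constructor <;> apply hf
    · simpa [reducedRemainder, map_ofNat] using h1
    · simpa [reducedRemainder, map_ofNat] using h2
    · simpa [map_ofNat] using h3
    · simpa [map_ofNat] using h4
  · rintro ⟨h1, h2, h3, h4⟩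
    constructor
    · simpa [reducedRemainder, map_ofNat] using congrArg f h1
    · simpa [reducedRemainder, map_ofNat] using congrArg f h2
    · simpa [map_ofNat] using congrArg f h3
    · simpa [map_ofNat] using congrArg f h4

/-- Since `t * (4 * p - 1) = V`, the growing terms disappear from the `q` equations. These are then
multiplied by 2 and the `p` equations by `-8` to clear denominators. -/
theorem sasanoEqs_iff_reduced {K : Type*} [Field K] [CharZero K]
    {α₀ α₁ α₃ X t q₁ p₁ q₂ p₂ V₁ V₂ θq₁ θp₁ θq₂ θp₂ θV₁ θV₂ : K} (ht : t * X = 1)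
    (hp₁ : 4 * p₁ = 1 + X * V₁) (hp₂ : 4 * p₂ = 1 + X * V₂)
    (hθp₁ : 4 * θp₁ = X * (θV₁ - V₁)) (hθp₂ : 4 * θp₂ = X * (θV₂ - V₂)) :
    SasanoEqs α₀ α₁ α₃ t q₁ p₁ q₂ p₂ θq₁ θp₁ θq₂ θp₂ ↔
      ReducedSasanoEqs α₀ α₁ α₃ X q₁ V₁ q₂ V₂ θq₁ θV₁ θq₂ θV₂ := by
  have e₁ : p₁ = (1 + X * V₁) / 4 := by linear_combination hp₁ / 4
  have e₂ : p₂ = (1 + X * V₂) / 4 := by linear_combination hp₂ / 4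
  have e₃ : θp₁ = X * (θV₁ - V₁) / 4 := by linear_combination hθp₁ / 4
  have e₄ : θp₂ = X * (θV₂ - V₂) / 4 := by linear_combination hθp₂ / 4
  subst e₁ e₂ e₃ e₄
  constructor
  · rintro ⟨h1, h2, h3, h4⟩
    constructor
    · rw [reducedRemainder]; linear_combination -8 * h2
    · rw [reducedRemainder]; linear_combination -8 * h4
    · linear_combination 2 * h1 + 2 * V₂ * ht
    · linear_combination 2 * h3 + 2 * V₁ * ht
  · rintro ⟨h1, h2, h3, h4⟩
    rw [reducedRemainder] at h1 h2
    constructor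
    · linear_combination h3 / 2 - V₂ * ht
    · linear_combination -h1 / 8
    · linear_combination h4 / 2 - V₁ * ht
    · linear_combination -h2 / 8

instance : CharZero (LaurentSeries ℂ) :=
  charZero_of_injective_ringHom (HahnSeries.C_injective (Γ := ℤ) (R := ℂ))

theorem isFormalSolutionAtInfty_iff_reduced {α₀ α₁ α₃ : ℂ} {p₁ p₂ : LaurentSeries ℂ}
    {Q₁ V₁ Q₂ V₂ : PowerSeries ℂ}
    (hp₁ : 4 * p₁ = HahnSeries.ofPowerSeries ℤ ℂ (1 + PowerSeries.X * V₁))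
    (hp₂ : 4 * p₂ = HahnSeries.ofPowerSeries ℤ ℂ (1 + PowerSeries.X * V₂)) :
    IsFormalSolutionAtInfty α₀ α₁ α₃ (HahnSeries.ofPowerSeries ℤ ℂ Q₁) p₁
        (HahnSeries.ofPowerSeries ℤ ℂ Q₂) p₂ ↔
      ReducedSasanoEqs (PowerSeries.C α₀) (PowerSeries.C α₁) (PowerSeries.C α₃) PowerSeries.X
        Q₁ V₁ Q₂ V₂ (powerTheta Q₁) (powerTheta V₁) (powerTheta Q₂) (powerTheta V₂) := by
  have hθ : ∀ (p : LaurentSeries ℂ) (V : PowerSeries ℂ),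
      4 * p = HahnSeries.ofPowerSeries ℤ ℂ (1 + PowerSeries.X * V) →
      4 * thetaInfty p = HahnSeries.ofPowerSeries ℤ ℂ PowerSeries.X *
        (HahnSeries.ofPowerSeries ℤ ℂ (powerTheta V) - HahnSeries.ofPowerSeries ℤ ℂ V) := by
    intro p V hp
    have h4 : 4 * thetaInfty p = thetaInfty (4 * p) := by
      rw [show 4 * p = p + p + (p + p) by ring]
      simp only [thetaInfty_add]
      ring
    rw [h4, hp, thetaInfty_ofPowerSeries, powerTheta_one_add_X_mul, map_mul, map_sub]
  rw [← reducedSasanoEqs_map_iff (HahnSeries.ofPowerSeries ℤ ℂ) HahnSeries.ofPowerSeries_injective,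
    IsFormalSolutionAtInfty, sasanoEqs_iff_reduced ?_ ?_ ?_ (hθ p₁ V₁ hp₁) (hθ p₂ V₂ hp₂)]
  · simp only [HahnSeries.ofPowerSeries_C, thetaInfty_ofPowerSeries]
  · rw [HahnSeries.ofPowerSeries_X, HahnSeries.single_mul_single]
    simp
  · simpa using hp₁
  · simpa using hp₂

/-- The value of `V₂` determined by the equation for `Q₁` in `ReducedSasanoEqs`. -/
def reducedSolve {R : Type*} [CommRing R] (a e X Q V Q' V' θQ : R) : R :=
  θQ + Q ^ 2 - a * Q - 4 * e * (Q ^ 2 * (1 + X * V) + Q * Q' * (1 + X * V'))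

/-- The system `ReducedSasanoEqs` in solved form, `e` being the inverse of `8`. -/
theorem reducedSasanoEqs_iff {R : Type*} [CommRing R]
    {α₀ α₁ α₃ e X Q₁ V₁ Q₂ V₂ θQ₁ θV₁ θQ₂ θV₂ : R} (he : 8 * e = 1) :
    ReducedSasanoEqs α₀ α₁ α₃ X Q₁ V₁ Q₂ V₂ θQ₁ θV₁ θQ₂ θV₂ ↔
      -2 * α₀ + α₃ -
          X * (e * (3 * reducedRemainder (α₀ + α₁ + α₃) X Q₁ V₁ Q₂ V₂ θV₁ +
            reducedRemainder (α₀ + α₁ + α₃) X Q₂ V₂ Q₁ V₁ θV₂)) = Q₁ ∧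
        -2 * α₁ + α₃ -
          X * (e * (reducedRemainder (α₀ + α₁ + α₃) X Q₁ V₁ Q₂ V₂ θV₁ +
            3 * reducedRemainder (α₀ + α₁ + α₃) X Q₂ V₂ Q₁ V₁ θV₂)) = Q₂ ∧
        reducedSolve (α₀ + α₁ + α₃) e X Q₂ V₂ Q₁ V₁ θQ₂ = V₁ ∧
        reducedSolve (α₀ + α₁ + α₃) e X Q₁ V₁ Q₂ V₂ θQ₁ = V₂ := by
  set S₁ := reducedRemainder (α₀ + α₁ + α₃) X Q₁ V₁ Q₂ V₂ θV₁ with hS₁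
  set S₂ := reducedRemainder (α₀ + α₁ + α₃) X Q₂ V₂ Q₁ V₁ θV₂ with hS₂
  unfold reducedSolve
  constructor
  · rintro ⟨h1, h2, h3, h4⟩
    rw [← hS₁] at h1
    rw [← hS₂] at h2
    refine ⟨?_, ?_, ?_, ?_⟩
    -- The coefficients come from the inverse of the matrix with rows `(3, -1)` and `(-1, 3)`, whose
    -- determinant is 8.
    · linear_combination -3 * e * h1 - e * h2 + (Q₁ + 2 * α₀ - α₃) * he
    · linear_combination -e * h1 - 3 * e * h2 + (Q₂ + 2 * α₁ - α₃) * he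
    · linear_combination 4 * e * h4 + (V₁ - θQ₂ - Q₂ ^ 2 + (α₀ + α₁ + α₃) * Q₂) * he
    · linear_combination 4 * e * h3 + (V₂ - θQ₁ - Q₁ ^ 2 + (α₀ + α₁ + α₃) * Q₁) * he
  · rintro ⟨h1, h2, h3, h4⟩
    constructor
    · linear_combination -3 * h1 + h2 - X * S₁ * he
    · linear_combination -3 * h2 + h1 - X * S₂ * he
    · linear_combination 2 * h4 + (Q₁ ^ 2 * (1 + X * V₁) + Q₁ * Q₂ * (1 + X * V₂)) * he
    · linear_combination 2 * h3 + (Q₂ ^ 2 * (1 + X * V₂) + Q₂ * Q₁ * (1 + X * V₁)) * he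

theorem EqUpTo.reducedRemainder {n : ℕ} {Q V Q' V' θV G W G' W' θW a : PowerSeries ℂ}
    (hQ : EqUpTo n Q G) (hV : EqUpTo n V W) (hQ' : EqUpTo n Q' G') (hV' : EqUpTo n V' W')
    (hθ : EqUpTo n θV θW) :
    EqUpTo n (reducedRemainder a PowerSeries.X Q V Q' V' θV)
      (reducedRemainder a PowerSeries.X G W G' W' θW) := by
  have hX := EqUpTo.refl n PowerSeries.X
  have h2 := EqUpTo.refl n 2
  exact (((hQ.mul ((h2.mul hV).sub (hX.mul hV.pow))).sub
    (hQ'.mul ((hV.add hV').add ((hX.mul hV).mul hV')))).sub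
    ((EqUpTo.refl n (2 * a)).mul hV)).sub (h2.mul (hθ.sub hV))

/-- Agreement of `V`, `V'` is needed only to degree `n`, because they enter multiplied by `X`; `Q`,
`Q'` and `θQ` enter without that factor. -/
theorem EqUpTo.reducedSolve {n : ℕ} {Q V Q' V' θQ G W G' W' θG a e : PowerSeries ℂ}
    (hQ : EqUpTo (n + 1) Q G) (hV : EqUpTo n V W) (hQ' : EqUpTo (n + 1) Q' G')
    (hV' : EqUpTo n V' W') (hθ : EqUpTo (n + 1) θQ θG) :
    EqUpTo (n + 1) (reducedSolve a e PowerSeries.X Q V Q' V' θQ)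
      (reducedSolve a e PowerSeries.X G W G' W' θG) := by
  have h1 := EqUpTo.refl (n + 1) 1
  exact ((hθ.add hQ.pow).sub ((EqUpTo.refl _ a).mul hQ)).sub ((EqUpTo.refl _ (4 * e)).mul
    ((hQ.pow.mul (h1.add hV.X_mul)).add ((hQ.mul hQ').mul (h1.add hV'.X_mul))))

theorem exists_reducedSasanoEqs_unique (α₀ α₁ α₃ : ℂ) :
    ∃ Q₁ V₁ Q₂ V₂ : PowerSeries ℂ, ∀ q₁ v₁ q₂ v₂ : PowerSeries ℂ,
      ReducedSasanoEqs (PowerSeries.C α₀) (PowerSeries.C α₁) (PowerSeries.C α₃) PowerSeries.X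
        q₁ v₁ q₂ v₂ (powerTheta q₁) (powerTheta v₁) (powerTheta q₂) (powerTheta v₂) ↔
      q₁ = Q₁ ∧ v₁ = V₁ ∧ q₂ = Q₂ ∧ v₂ = V₂ := by
  set a : PowerSeries ℂ := PowerSeries.C α₀ + PowerSeries.C α₁ + PowerSeries.C α₃ with ha
  set e : PowerSeries ℂ := PowerSeries.C (1 / 8) with he
  have he8 : 8 * e = 1 := by
    rw [he, ← map_ofNat (PowerSeries.C (R := ℂ)) 8, ← map_mul, ← map_one (PowerSeries.C (R := ℂ))]
    norm_num
  set S : PowerSeries ℂ → PowerSeries ℂ → PowerSeries ℂ → PowerSeries ℂ → PowerSeries ℂ :=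
    fun Q V Q' V' => reducedRemainder a PowerSeries.X Q V Q' V' (powerTheta V) with hS
  set A₁ : (Fin 4 → PowerSeries ℂ) → PowerSeries ℂ := fun F =>
    -2 * PowerSeries.C α₀ + PowerSeries.C α₃ -
      PowerSeries.X * (e * (3 * S (F 0) (F 1) (F 2) (F 3) + S (F 2) (F 3) (F 0) (F 1))) with hA₁
  set A₂ : (Fin 4 → PowerSeries ℂ) → PowerSeries ℂ := fun F =>
    -2 * PowerSeries.C α₁ + PowerSeries.C α₃ -
      PowerSeries.X * (e * (S (F 0) (F 1) (F 2) (F 3) + 3 * S (F 2) (F 3) (F 0) (F 1))) with hA₂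
  -- The `V` components are computed from the updated values `A₁ F`, `A₂ F` instead of `F 0`, `F 2`.
  -- The update has already gained a degree of agreement, without which `T` would not contract; the
  -- fixed points are unaffected.
  set T : (Fin 4 → PowerSeries ℂ) → Fin 4 → PowerSeries ℂ := fun F =>
    ![A₁ F, reducedSolve a e PowerSeries.X (A₂ F) (F 3) (A₁ F) (F 1) (powerTheta (A₂ F)),
      A₂ F, reducedSolve a e PowerSeries.X (A₁ F) (F 1) (A₂ F) (F 3) (powerTheta (A₁ F))] with hT
  obtain ⟨F, hTF, hF⟩ : ∃! F, T F = F := by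
    refine existsUnique_fixedPoint_of_contracting T fun n F G h => ?_
    have hS₁ : EqUpTo n (S (F 0) (F 1) (F 2) (F 3)) (S (G 0) (G 1) (G 2) (G 3)) :=
      (h 0).reducedRemainder (h 1) (h 2) (h 3) (h 1).theta
    have hS₂ : EqUpTo n (S (F 2) (F 3) (F 0) (F 1)) (S (G 2) (G 3) (G 0) (G 1)) :=
      (h 2).reducedRemainder (h 3) (h 0) (h 1) (h 3).theta
    have h3 := EqUpTo.refl n 3
    have h1 : EqUpTo (n + 1) (A₁ F) (A₁ G) :=
      (EqUpTo.refl _ _).sub ((EqUpTo.refl n e).mul ((h3.mul hS₁).add hS₂)).X_mul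
    have h2 : EqUpTo (n + 1) (A₂ F) (A₂ G) :=
      (EqUpTo.refl _ _).sub ((EqUpTo.refl n e).mul (hS₁.add (h3.mul hS₂))).X_mul
    intro i
    fin_cases i
    · exact h1
    · exact h2.reducedSolve (h 3) h1 (h 1) h2.theta
    · exact h2
    · exact h1.reducedSolve (h 1) h2 (h 3) h1.theta
  refine ⟨F 0, F 1, F 2, F 3, fun q₁ v₁ q₂ v₂ => ?_⟩
  have hiff : ReducedSasanoEqs (PowerSeries.C α₀) (PowerSeries.C α₁) (PowerSeries.C α₃)
      PowerSeries.X q₁ v₁ q₂ v₂ (powerTheta q₁) (powerTheta v₁) (powerTheta q₂) (powerTheta v₂) ↔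
      T ![q₁, v₁, q₂, v₂] = ![q₁, v₁, q₂, v₂] := by
    rw [reducedSasanoEqs_iff he8]
    constructor
    · rintro ⟨h1, h2, h3, h4⟩
      have g1 : A₁ ![q₁, v₁, q₂, v₂] = q₁ := h1
      have g2 : A₂ ![q₁, v₁, q₂, v₂] = q₂ := h2
      funext i
      fin_cases i
      · exact g1
      · simpa [hT, g1, g2] using h3
      · exact g2
      · simpa [hT, g1, g2] using h4
    · intro h
      have g1 : A₁ ![q₁, v₁, q₂, v₂] = q₁ := congrFun h 0
      have g2 : A₂ ![q₁, v₁, q₂, v₂] = q₂ := congrFun h 2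
      have h3 := congrFun h 1
      have h4 := congrFun h 3
      refine ⟨g1, g2, ?_, ?_⟩
      · simpa [hT, g1, g2] using h3
      · simpa [hT, g1, g2] using h4
  rw [hiff]
  constructor
  · intro h
    rw [← hF _ h]
    exact ⟨rfl, rfl, rfl, rfl⟩
  · rintro ⟨rfl, rfl, rfl, rfl⟩
    have : ![F 0, F 1, F 2, F 3] = F := by
      funext i
      fin_cases i <;> rfl
    rw [this]
    exact hTF

/-! ### The formal solution -/

theorem OrdGE.exists_ofPowerSeries {x : LaurentSeries ℂ} (h : OrdGE 0 x) :
    ∃ F : PowerSeries ℂ, x = HahnSeries.ofPowerSeries ℤ ℂ F := by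
  refine ⟨PowerSeries.mk fun n => x.coeff n, ?_⟩
  ext k
  rw [PowerSeries.coeff_coe]
  split_ifs with hk
  · exact ordGE_iff.1 h k hk
  · rw [PowerSeries.coeff_mk, Int.natAbs_of_nonneg (not_lt.1 hk)]

theorem OrdGE.exists_X_mul {x : LaurentSeries ℂ} (h : OrdGE 1 x) :
    ∃ F : PowerSeries ℂ, x = HahnSeries.ofPowerSeries ℤ ℂ (PowerSeries.X * F) := by
  obtain ⟨F, hF⟩ := (ordEq_single_neg_one.ordGE.mul h).exists_ofPowerSeries
  refine ⟨F, ?_⟩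
  rw [map_mul, ← hF, HahnSeries.ofPowerSeries_X, ← mul_assoc, HahnSeries.single_mul_single]
  simp

theorem IsFormalSolutionAtInfty.exists_reduced {α₀ α₁ α₃ : ℂ} {q₁ p₁ q₂ p₂ : LaurentSeries ℂ}
    (h : IsFormalSolutionAtInfty α₀ α₁ α₃ q₁ p₁ q₂ p₂) :
    ∃ Q₁ V₁ Q₂ V₂ : PowerSeries ℂ,
      q₁ = HahnSeries.ofPowerSeries ℤ ℂ Q₁ ∧
      4 * p₁ = HahnSeries.ofPowerSeries ℤ ℂ (1 + PowerSeries.X * V₁) ∧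
      q₂ = HahnSeries.ofPowerSeries ℤ ℂ Q₂ ∧
      4 * p₂ = HahnSeries.ofPowerSeries ℤ ℂ (1 + PowerSeries.X * V₂) := by
  obtain ⟨h1, h2, h3, h4⟩ := h.ordGE
  obtain ⟨Q₁, hQ₁⟩ := h1.exists_ofPowerSeries
  obtain ⟨V₁, hV₁⟩ := h2.exists_X_mul
  obtain ⟨Q₂, hQ₂⟩ := h3.exists_ofPowerSeries
  obtain ⟨V₂, hV₂⟩ := h4.exists_X_mul
  refine ⟨Q₁, V₁, Q₂, V₂, hQ₁, ?_, hQ₂, ?_⟩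
  · rw [map_add, map_one, ← hV₁]; ring
  · rw [map_add, map_one, ← hV₂]; ring

theorem four_mul_ofPowerSeries (F : PowerSeries ℂ) :
    4 * HahnSeries.ofPowerSeries ℤ ℂ (PowerSeries.C (1 / 4) * F) =
      HahnSeries.ofPowerSeries ℤ ℂ F := by
  rw [← map_ofNat (HahnSeries.ofPowerSeries ℤ ℂ) 4, ← map_mul, ← mul_assoc,
    ← map_ofNat (PowerSeries.C (R := ℂ)) 4, ← map_mul]
  norm_num

theorem constantCoeff_powerTheta (F : PowerSeries ℂ) :
    PowerSeries.constantCoeff (powerTheta F) = 0 := by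
  rw [← PowerSeries.coeff_zero_eq_constantCoeff_apply, powerTheta, PowerSeries.coeff_mk]
  simp

theorem exists_isFormalSolutionAtInfty_unique (α₀ α₁ α₃ : ℂ) :
    ∃ Q₁ P₁ Q₂ P₂ : PowerSeries ℂ,
      (PowerSeries.coeff 0 Q₁ = -2 * α₀ + α₃ ∧
        PowerSeries.coeff 0 P₁ = 1 / 4 ∧
        PowerSeries.coeff 1 P₁ = (-2 * α₁ + α₃) * (-2 * α₁ - α₃) / 4 ∧
        PowerSeries.coeff 0 Q₂ = -2 * α₁ + α₃ ∧
        PowerSeries.coeff 0 P₂ = 1 / 4 ∧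
        PowerSeries.coeff 1 P₂ = (-2 * α₀ + α₃) * (-2 * α₀ - α₃) / 4) ∧
      ∀ q₁ p₁ q₂ p₂ : LaurentSeries ℂ,
        IsFormalSolutionAtInfty α₀ α₁ α₃ q₁ p₁ q₂ p₂ ↔
          q₁ = HahnSeries.ofPowerSeries ℤ ℂ Q₁ ∧ p₁ = HahnSeries.ofPowerSeries ℤ ℂ P₁ ∧
          q₂ = HahnSeries.ofPowerSeries ℤ ℂ Q₂ ∧ p₂ = HahnSeries.ofPowerSeries ℤ ℂ P₂ := by
  obtain ⟨Q₁, V₁, Q₂, V₂, h⟩ := exists_reducedSasanoEqs_unique α₀ α₁ α₃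
  refine ⟨Q₁, PowerSeries.C (1 / 4) * (1 + PowerSeries.X * V₁), Q₂,
    PowerSeries.C (1 / 4) * (1 + PowerSeries.X * V₂), ?_, ?_⟩
  · obtain ⟨e1, e2, e3, e4⟩ := (h Q₁ V₁ Q₂ V₂).2 ⟨rfl, rfl, rfl, rfl⟩
    have f1 := congrArg PowerSeries.constantCoeff e1
    have f2 := congrArg PowerSeries.constantCoeff e2
    have f3 := congrArg PowerSeries.constantCoeff e3
    have f4 := congrArg PowerSeries.constantCoeff e4
    simp only [map_add, map_sub, map_mul, map_pow, map_ofNat, map_one, map_zero,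
      PowerSeries.constantCoeff_X, PowerSeries.constantCoeff_C, constantCoeff_powerTheta]
      at f1 f2 f3 f4
    -- At `X = 0` the `p` equations are a linear system for the constant terms of `Q₁`, `Q₂`; the
    -- `q` equations then give those of `V₁`, `V₂`, with indices crossed.
    have g1 : PowerSeries.constantCoeff Q₁ = -2 * α₀ + α₃ := by
      linear_combination 3 / 8 * f1 + f2 / 8
    have g2 : PowerSeries.constantCoeff Q₂ = -2 * α₁ + α₃ := by
      linear_combination f1 / 8 + 3 / 8 * f2
    rw [g1, g2] at f3 f4
    have hc : ∀ V : PowerSeries ℂ,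
        PowerSeries.coeff 0 (PowerSeries.C (1 / 4) * (1 + PowerSeries.X * V)) = 1 / 4 := by
      intro V
      simp
    have hc' : ∀ V : PowerSeries ℂ,
        PowerSeries.coeff 1 (PowerSeries.C (1 / 4) * (1 + PowerSeries.X * V)) =
          PowerSeries.constantCoeff V / 4 := by
      intro V
      rw [PowerSeries.coeff_C_mul, map_add, PowerSeries.coeff_one, if_neg one_ne_zero,
        PowerSeries.coeff_succ_X_mul 0, PowerSeries.coeff_zero_eq_constantCoeff_apply]
      ring
    refine ⟨by simpa using g1, hc V₁, ?_, by simpa using g2, hc V₂, ?_⟩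
    · rw [hc']
      linear_combination -f4 / 8
    · rw [hc']
      linear_combination -f3 / 8
  · intro q₁ p₁ q₂ p₂
    constructor
    · intro hs
      obtain ⟨G₁, W₁, G₂, W₂, rfl, hp₁, rfl, hp₂⟩ := hs.exists_reduced
      obtain ⟨rfl, rfl, rfl, rfl⟩ :=
        (h _ _ _ _).1 ((isFormalSolutionAtInfty_iff_reduced hp₁ hp₂).1 hs)
      refine ⟨rfl, ?_, rfl, ?_⟩
      · rw [← four_mul_ofPowerSeries] at hp₁
        exact mul_left_cancel₀ (OfNat.ofNat_ne_zero 4) hp₁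
      · rw [← four_mul_ofPowerSeries] at hp₂
        exact mul_left_cancel₀ (OfNat.ofNat_ne_zero 4) hp₂
    · rintro ⟨rfl, rfl, rfl, rfl⟩
      exact (isFormalSolutionAtInfty_iff_reduced (four_mul_ofPowerSeries _)
        (four_mul_ofPowerSeries _)).2 ((h _ _ _ _).2 ⟨rfl, rfl, rfl, rfl⟩)

/-! ### Laurent expansions of meromorphic germs -/

/-- The Taylor series of `g` at `0`. -/
noncomputable def taylorAtZero (g : ℂ → ℂ) : PowerSeries ℂ :=
  PowerSeries.mk fun n => iteratedDeriv n g 0 / n.factorial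

theorem taylorAtZero_congr {f g : ℂ → ℂ} (h : f =ᶠ[𝓝 0] g) : taylorAtZero f = taylorAtZero g := by
  ext n
  rw [taylorAtZero, taylorAtZero, PowerSeries.coeff_mk, PowerSeries.coeff_mk,
    h.iteratedDeriv_eq n]

theorem taylorAtZero_add {f g : ℂ → ℂ} (hf : AnalyticAt ℂ f 0) (hg : AnalyticAt ℂ g 0) :
    taylorAtZero (fun s => f s + g s) = taylorAtZero f + taylorAtZero g := by
  ext n
  simp only [taylorAtZero, map_add, PowerSeries.coeff_mk,
    iteratedDeriv_fun_add hf.contDiffAt hg.contDiffAt, add_div]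

theorem taylorAtZero_mul {f g : ℂ → ℂ} (hf : AnalyticAt ℂ f 0) (hg : AnalyticAt ℂ g 0) :
    taylorAtZero (fun s => f s * g s) = taylorAtZero f * taylorAtZero g := by
  ext n
  rw [PowerSeries.coeff_mul, Finset.Nat.sum_antidiagonal_eq_sum_range_succ_mk]
  simp only [taylorAtZero, PowerSeries.coeff_mk,
    iteratedDeriv_fun_mul hf.contDiffAt hg.contDiffAt, Finset.sum_div]
  refine Finset.sum_congr rfl fun i hi => ?_
  rw [Nat.cast_choose ℂ (Nat.lt_succ_iff.1 (Finset.mem_range.1 hi))]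
  have h1 : (n.factorial : ℂ) ≠ 0 := by exact_mod_cast n.factorial_ne_zero
  have h2 : (i.factorial : ℂ) ≠ 0 := by exact_mod_cast i.factorial_ne_zero
  have h3 : ((n - i).factorial : ℂ) ≠ 0 := by exact_mod_cast (n - i).factorial_ne_zero
  field_simp

theorem taylorAtZero_const (c : ℂ) : taylorAtZero (fun _ => c) = PowerSeries.C c := by
  ext n
  rw [taylorAtZero, PowerSeries.coeff_mk, iteratedDeriv_const, PowerSeries.coeff_C]
  by_cases hn : n = 0 <;> simp [hn]

theorem taylorAtZero_id : taylorAtZero (fun s => s) = PowerSeries.X := by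
  ext n
  rw [taylorAtZero, PowerSeries.coeff_mk, iteratedDeriv_fun_id_zero, PowerSeries.coeff_X]
  by_cases hn : n = 1 <;> simp [hn]

theorem taylorAtZero_pow (N : ℕ) : taylorAtZero (fun s => s ^ N) = PowerSeries.X ^ N := by
  induction N with
  | zero => simpa using taylorAtZero_const 1
  | succ N ih =>
    simp only [pow_succ]
    rw [taylorAtZero_mul (by fun_prop) (by fun_prop), ih, taylorAtZero_id]

theorem taylorAtZero_mul_deriv {g : ℂ → ℂ} (hg : AnalyticAt ℂ g 0) :
    taylorAtZero (fun s => s * deriv g s) = -powerTheta (taylorAtZero g) := by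
  rw [taylorAtZero_mul (by fun_prop) hg.deriv, taylorAtZero_id]
  ext n
  cases n with
  | zero => simp [powerTheta]
  | succ n =>
    rw [PowerSeries.coeff_succ_X_mul]
    simp only [taylorAtZero, powerTheta, map_neg, PowerSeries.coeff_mk, ← iteratedDeriv_succ',
      Nat.factorial_succ]
    have h1 : (n.factorial : ℂ) ≠ 0 := by exact_mod_cast n.factorial_ne_zero
    have h2 : (n + 1 : ℂ) ≠ 0 := by exact_mod_cast n.succ_ne_zero
    push_cast
    field_simp

/-- `F` is the Laurent expansion at `0` of `f`. -/
def HasLaurentExpansion (f : ℂ → ℂ) (F : LaurentSeries ℂ) : Prop :=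
  ∃ (N : ℕ) (g : ℂ → ℂ), AnalyticAt ℂ g 0 ∧ (∀ᶠ s in 𝓝[≠] 0, s ^ N * f s = g s) ∧
    HahnSeries.ofPowerSeries ℤ ℂ PowerSeries.X ^ N * F =
      HahnSeries.ofPowerSeries ℤ ℂ (taylorAtZero g)

/-- Multiplying crosswise by `s ^ M` and `s ^ N` reduces the claim to Taylor series of analytic
functions. This turns identities between germs into formal identities. -/
theorem HasLaurentExpansion.unique {f f' : ℂ → ℂ} {F F' : LaurentSeries ℂ}
    (h : HasLaurentExpansion f F) (h' : HasLaurentExpansion f' F') (hff' : f =ᶠ[𝓝[≠] 0] f') :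
    F = F' := by
  obtain ⟨N, g, hg, hfg, hF⟩ := h
  obtain ⟨M, k, hk, hfk, hF'⟩ := h'
  have hp : ∀ n : ℕ, AnalyticAt ℂ (fun s : ℂ => s ^ n) 0 := fun n => by fun_prop
  have h1 : (fun s => s ^ M * g s) =ᶠ[𝓝[≠] 0] fun s => s ^ N * k s := by
    filter_upwards [hfg, hfk, hff'] with s h1 h2 h3
    rw [← h1, ← h2, h3]
    ring
  -- By the identity theorem, agreement on the punctured neighbourhood extends to 0.
  have h2 := taylorAtZero_congr
    ((((hp M).fun_mul hg).frequently_eq_iff_eventually_eq ((hp N).fun_mul hk)).1 h1.frequently)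
  rw [taylorAtZero_mul (hp M) hg, taylorAtZero_mul (hp N) hk, taylorAtZero_pow,
    taylorAtZero_pow] at h2
  have h3 := congrArg (HahnSeries.ofPowerSeries ℤ ℂ) h2
  rw [map_mul, map_mul, ← hF, ← hF', map_pow, map_pow] at h3
  have hX : HahnSeries.ofPowerSeries ℤ ℂ PowerSeries.X ≠ 0 := by
    rw [HahnSeries.ofPowerSeries_X]
    exact HahnSeries.single_ne_zero one_ne_zero
  refine mul_left_cancel₀ (pow_ne_zero (N + M) hX) ?_
  linear_combination h3

theorem HasLaurentExpansion.add {f f' : ℂ → ℂ} {F F' : LaurentSeries ℂ}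
    (h : HasLaurentExpansion f F) (h' : HasLaurentExpansion f' F') :
    HasLaurentExpansion (fun s => f s + f' s) (F + F') := by
  obtain ⟨N, g, hg, hfg, hF⟩ := h
  obtain ⟨M, k, hk, hfk, hF'⟩ := h'
  have hp : ∀ n : ℕ, AnalyticAt ℂ (fun s : ℂ => s ^ n) 0 := fun n => by fun_prop
  refine ⟨N + M, fun s => s ^ M * g s + s ^ N * k s, ((hp M).fun_mul hg).fun_add
    ((hp N).fun_mul hk), ?_, ?_⟩
  · filter_upwards [hfg, hfk] with s h1 h2
    rw [← h1, ← h2]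
    ring
  · rw [taylorAtZero_add ((hp M).fun_mul hg) ((hp N).fun_mul hk), taylorAtZero_mul (hp M) hg,
      taylorAtZero_mul (hp N) hk, taylorAtZero_pow, taylorAtZero_pow]
    simp only [map_add, map_mul, map_pow]
    rw [← hF, ← hF']
    ring

theorem HasLaurentExpansion.mul {f f' : ℂ → ℂ} {F F' : LaurentSeries ℂ}
    (h : HasLaurentExpansion f F) (h' : HasLaurentExpansion f' F') :
    HasLaurentExpansion (fun s => f s * f' s) (F * F') := by
  obtain ⟨N, g, hg, hfg, hF⟩ := h
  obtain ⟨M, k, hk, hfk, hF'⟩ := h'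
  refine ⟨N + M, fun s => g s * k s, hg.mul hk, ?_, ?_⟩
  · filter_upwards [hfg, hfk] with s h1 h2
    rw [← h1, ← h2]
    ring
  · rw [taylorAtZero_mul hg hk, map_mul, ← hF, ← hF']
    ring

theorem hasLaurentExpansion_const (c : ℂ) :
    HasLaurentExpansion (fun _ => c) (HahnSeries.C c) :=
  ⟨0, fun _ => c, by fun_prop, by simp,
    by rw [taylorAtZero_const, HahnSeries.ofPowerSeries_C, pow_zero, one_mul]⟩

theorem hasLaurentExpansion_ofNat (n : ℕ) [n.AtLeastTwo] :
    HasLaurentExpansion (fun _ => OfNat.ofNat n) (OfNat.ofNat n) := by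
  rw [← map_ofNat HahnSeries.C n]
  exact hasLaurentExpansion_const _

theorem HasLaurentExpansion.neg {f : ℂ → ℂ} {F : LaurentSeries ℂ} (h : HasLaurentExpansion f F) :
    HasLaurentExpansion (fun s => -f s) (-F) := by
  have h1 : HahnSeries.C (-1) * F = -F := by
    ext k
    rw [HahnSeries.C_mul_eq_smul, HahnSeries.coeff_smul, HahnSeries.coeff_neg, smul_eq_mul,
      neg_one_mul]
  simpa only [h1, neg_one_mul] using (hasLaurentExpansion_const (-1)).mul h

theorem HasLaurentExpansion.sub {f f' : ℂ → ℂ} {F F' : LaurentSeries ℂ}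
    (h : HasLaurentExpansion f F) (h' : HasLaurentExpansion f' F') :
    HasLaurentExpansion (fun s => f s - f' s) (F - F') := by
  simpa only [sub_eq_add_neg] using h.add h'.neg

theorem HasLaurentExpansion.sq {f : ℂ → ℂ} {F : LaurentSeries ℂ} (h : HasLaurentExpansion f F) :
    HasLaurentExpansion (fun s => f s ^ 2) (F ^ 2) := by
  simpa only [pow_two] using h.mul h

theorem hasLaurentExpansion_inv :
    HasLaurentExpansion (fun s => s⁻¹) (HahnSeries.single (-1 : ℤ) (1 : ℂ)) := by
  refine ⟨1, fun _ => 1, by fun_prop, ?_, ?_⟩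
  · filter_upwards [self_mem_nhdsWithin] with s hs
    rw [pow_one, mul_inv_cancel₀ hs]
  · rw [taylorAtZero_const, HahnSeries.ofPowerSeries_X, pow_one, HahnSeries.single_mul_single]
    simp

theorem ofPowerSeries_X_pow_mul_coeff (N : ℕ) (F : LaurentSeries ℂ) (k : ℤ) :
    (HahnSeries.ofPowerSeries ℤ ℂ PowerSeries.X ^ N * F).coeff k = F.coeff (k - N) := by
  have h := HahnSeries.coeff_single_mul_add (r := (1 : ℂ)) (x := F) (a := k - N) (b := (N : ℤ))
  rw [sub_add_cancel, one_mul] at h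
  rw [← h, ← map_pow, HahnSeries.ofPowerSeries_X_pow]

/-- Leibniz rule for `θ`, with `θ(X ^ N) = -N X ^ N`. -/
theorem X_pow_mul_thetaInfty (N : ℕ) (F : LaurentSeries ℂ) :
    HahnSeries.ofPowerSeries ℤ ℂ PowerSeries.X ^ N * thetaInfty F =
      thetaInfty (HahnSeries.ofPowerSeries ℤ ℂ PowerSeries.X ^ N * F) +
        HahnSeries.C (N : ℂ) * (HahnSeries.ofPowerSeries ℤ ℂ PowerSeries.X ^ N * F) := by
  ext k
  rw [HahnSeries.coeff_add, HahnSeries.C_mul_eq_smul, HahnSeries.coeff_smul, thetaInfty_coeff,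
    ofPowerSeries_X_pow_mul_coeff, ofPowerSeries_X_pow_mul_coeff, thetaInfty_coeff, smul_eq_mul]
  push_cast
  ring

theorem HasLaurentExpansion.mul_deriv {f : ℂ → ℂ} {F : LaurentSeries ℂ}
    (h : HasLaurentExpansion f F) (hf : ∀ᶠ s in 𝓝[≠] 0, DifferentiableAt ℂ f s) :
    HasLaurentExpansion (fun s => -(s * deriv f s)) (thetaInfty F) := by
  obtain ⟨N, g, hg, hfg, hF⟩ := h
  have h1 : AnalyticAt ℂ (fun s => (N : ℂ) * g s) 0 := by fun_prop
  have h2 : AnalyticAt ℂ (fun s => s * deriv g s) 0 := analyticAt_id.mul hg.deriv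
  have h3 : AnalyticAt ℂ (fun s => -1 * (s * deriv g s)) 0 := by fun_prop
  -- Differentiating `g = s ^ N * f` gives `s ^ N * (-(s * f')) = N * g - s * g'`, so the same `N`
  -- serves.
  refine ⟨N, fun s => (N : ℂ) * g s + -1 * (s * deriv g s), h1.add h3, ?_, ?_⟩
  · filter_upwards [hf, hfg, eventually_eventually_nhdsWithin.2 hfg, self_mem_nhdsWithin]
      with s hs hs' hev hs0
    have hev' : (fun z => z ^ N * f z) =ᶠ[𝓝 s] g := by
      rwa [IsOpen.nhdsWithin_eq isOpen_compl_singleton hs0] at hev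
    have hd := ((hasDerivAt_pow N s).mul hs.hasDerivAt).deriv
    have hd' : N * s ^ (N - 1) * f s + s ^ N * deriv f s = deriv g s := by
      rw [← hev'.deriv_eq]
      exact hd.symm
    rw [← hd', ← hs']
    cases N with
    | zero => simp
    | succ n =>
      simp only [Nat.add_sub_cancel]
      ring
  · rw [X_pow_mul_thetaInfty, hF, thetaInfty_ofPowerSeries, taylorAtZero_add h1 h3,
      taylorAtZero_mul (by fun_prop) hg, taylorAtZero_mul (by fun_prop) h2,
      taylorAtZero_mul_deriv hg, taylorAtZero_const, taylorAtZero_const, map_add, map_mul,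
      HahnSeries.ofPowerSeries_C, map_neg, map_one, neg_mul_neg, one_mul]
    ring

theorem MeromorphicAt.exists_hasLaurentExpansion {f : ℂ → ℂ} (hf : MeromorphicAt f 0) :
    ∃ F, HasLaurentExpansion f F := by
  obtain ⟨N, hN⟩ := hf
  refine ⟨HahnSeries.single (-N : ℤ) 1 *
    HahnSeries.ofPowerSeries ℤ ℂ (taylorAtZero fun z => (z - 0) ^ N • f z), N, _, hN, ?_, ?_⟩
  · simp
  · rw [← mul_assoc, ← map_pow, HahnSeries.ofPowerSeries_X_pow, HahnSeries.single_mul_single]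
    simp

/-- If the Laurent expansion of `f` is a power series, then that series converges to `f`. -/
theorem HasLaurentExpansion.hasSum {f : ℂ → ℂ} {F : PowerSeries ℂ}
    (h : HasLaurentExpansion f (HahnSeries.ofPowerSeries ℤ ℂ F)) :
    ∀ᶠ s in 𝓝[≠] 0, HasSum (fun n : ℕ => PowerSeries.coeff n F * s ^ n) (f s) := by
  obtain ⟨N, g, hg, hfg, hF⟩ := h
  rw [← map_pow, ← map_mul] at hF
  have hF' := HahnSeries.ofPowerSeries_injective hF
  have hsum := hasFPowerSeriesAt_iff.1 hg.hasFPowerSeriesAt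
  filter_upwards [hfg, nhdsWithin_le_nhds hsum, self_mem_nhdsWithin] with s h1 h2 h3
  have h4 : HasSum (fun n : ℕ => PowerSeries.coeff n (PowerSeries.X ^ N * F) * s ^ n) (g s) := by
    rw [zero_add] at h2
    refine Eq.subst (motive := fun u => HasSum u (g s)) (funext fun n => ?_) h2
    rw [hF', taylorAtZero, PowerSeries.coeff_mk, FormalMultilinearSeries.coeff_ofScalars,
      smul_eq_mul, mul_comm]
  -- The Taylor series of `g` is `X ^ N * F`: its first `N` terms vanish, and the rest is divided by
  -- `s ^ N`.
  rw [← hasSum_nat_add_iff' N, Finset.sum_eq_zero, sub_zero] at h4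
  · have h5 := h4.mul_left (s ^ N)⁻¹
    have hs : s ^ N ≠ 0 := pow_ne_zero N h3
    rw [← h1, inv_mul_cancel_left₀ hs] at h5
    refine Eq.subst (motive := fun u => HasSum u (f s)) (funext fun n => ?_) h5
    rw [PowerSeries.coeff_X_pow_mul, pow_add]
    field_simp
  · intro i hi
    rw [PowerSeries.coeff_X_pow_mul', if_neg (by simpa using hi), zero_mul]

theorem HasLaurentExpansion.hasExpansionAtInfty {f : ℂ → ℂ} {F : PowerSeries ℂ}
    (h : HasLaurentExpansion (fun s => f s⁻¹) (HahnSeries.ofPowerSeries ℤ ℂ F)) :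
    HasExpansionAtInfty f F := by
  have h1 := tendsto_inv₀_cobounded'.eventually h.hasSum
  simp only [inv_inv] at h1
  exact h1

theorem HasLaurentExpansion.holomorphicAtInfty {f : ℂ → ℂ} {F : PowerSeries ℂ}
    (h : HasLaurentExpansion (fun s => f s⁻¹) (HahnSeries.ofPowerSeries ℤ ℂ F)) :
    HolomorphicAtInfty f := by
  classical
  -- At `s = 0` the convention `0⁻¹ = 0` would give the irrelevant value `f 0`, so the constant
  -- coefficient replaces it.
  refine ⟨fun s => if s = 0 then PowerSeries.coeff 0 F else f s⁻¹, ?_, ?_⟩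
  · refine HasFPowerSeriesAt.analyticAt
      (p := FormalMultilinearSeries.ofScalars ℂ fun n => PowerSeries.coeff n F) ?_
    rw [hasFPowerSeriesAt_iff]
    filter_upwards [eventually_nhdsWithin_iff.1 h.hasSum] with s hs
    simp only [FormalMultilinearSeries.coeff_ofScalars, smul_eq_mul, zero_add]
    split_ifs with h0
    · subst h0
      have h1 := hasSum_single (f := fun n : ℕ => (0 : ℂ) ^ n * PowerSeries.coeff n F) 0
        fun n hn => by simp [hn]
      simpa using h1
    · simpa only [mul_comm] using hs h0
  · filter_upwards [tendsto_inv₀_cobounded'.eventually self_mem_nhdsWithin] with t ht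
    rw [if_neg (by simpa using ht), inv_inv]

/-! ### From meromorphic solutions to formal solutions -/

/-- Under `s = 1 / t` the chain rule gives `t d/dt = -s d/ds`. -/
theorem hasLaurentExpansion_theta {q : ℂ → ℂ} {F : LaurentSeries ℂ}
    (h : HasLaurentExpansion (fun s => q s⁻¹) F)
    (hq : ∀ᶠ t in Bornology.cobounded ℂ, DifferentiableAt ℂ q t) :
    HasLaurentExpansion (fun s => s⁻¹ * deriv q s⁻¹) (thetaInfty F) := by
  have hd : ∀ᶠ s in 𝓝[≠] (0 : ℂ), DifferentiableAt ℂ q s⁻¹ ∧ s ≠ 0 :=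
    (tendsto_inv₀_nhdsNE_zero.eventually hq).and self_mem_nhdsWithin
  have hderiv : ∀ᶠ s in 𝓝[≠] (0 : ℂ),
      HasDerivAt (fun s => q s⁻¹) (deriv q s⁻¹ * -(s ^ 2)⁻¹) s := by
    filter_upwards [hd] with s hs
    exact hs.1.hasDerivAt.comp s (hasDerivAt_inv hs.2)
  obtain ⟨N, g, hg, hfg, hF⟩ := h.mul_deriv (hderiv.mono fun s hs => hs.differentiableAt)
  refine ⟨N, g, hg, ?_, hF⟩
  filter_upwards [hfg, hderiv, hd] with s h1 h2 h3
  rw [← h1, h2.deriv]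
  have := h3.2
  field_simp

/-- The Laurent expansions of a meromorphic solution form a formal solution. -/
theorem IsSolutionNearInfty.isFormalSolutionAtInfty {α₀ α₁ α₃ : ℂ} {q₁ p₁ q₂ p₂ : ℂ → ℂ}
    {Q₁ P₁ Q₂ P₂ : LaurentSeries ℂ} (h : IsSolutionNearInfty α₀ α₁ α₃ q₁ p₁ q₂ p₂)
    (hq₁ : HasLaurentExpansion (fun s => q₁ s⁻¹) Q₁)
    (hp₁ : HasLaurentExpansion (fun s => p₁ s⁻¹) P₁)
    (hq₂ : HasLaurentExpansion (fun s => q₂ s⁻¹) Q₂)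
    (hp₂ : HasLaurentExpansion (fun s => p₂ s⁻¹) P₂) :
    IsFormalSolutionAtInfty α₀ α₁ α₃ Q₁ P₁ Q₂ P₂ := by
  have hθq₁ := hasLaurentExpansion_theta hq₁ (h.mono fun t ht => ht.1)
  have hθp₁ := hasLaurentExpansion_theta hp₁ (h.mono fun t ht => ht.2.1)
  have hθq₂ := hasLaurentExpansion_theta hq₂ (h.mono fun t ht => ht.2.2.1)
  have hθp₂ := hasLaurentExpansion_theta hp₂ (h.mono fun t ht => ht.2.2.2.1)
  have heqs := tendsto_inv₀_nhdsNE_zero.eventually (h.mono fun t ht => ht.2.2.2.2)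
  have hA := ((hasLaurentExpansion_const α₀).add (hasLaurentExpansion_const α₁)).add
    (hasLaurentExpansion_const α₃)
  have ht := hasLaurentExpansion_inv
  have h2 := hasLaurentExpansion_ofNat 2
  have h4 := hasLaurentExpansion_ofNat 4
  -- Each equation holds on a punctured neighbourhood of `s = 0`; expanding both sides and using
  -- uniqueness of Laurent expansions gives its formal counterpart.
  constructor
  · exact hθq₁.unique ((((((h2.mul hq₁.sq).mul hp₁).sub hq₁.sq).add (hA.mul hq₁)).sub ht).add
      ((h4.mul ht).mul hp₂) |>.add (((h2.mul hq₁).mul hq₂).mul hp₂))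
      (heqs.mono fun s hs => hs.eq_q₁)
  · exact hθp₁.unique ((((((h2.neg.mul hq₁).mul hp₁.sq).add ((h2.mul hq₁).mul hp₁)).sub
      (hA.mul hp₁)).add (hasLaurentExpansion_const α₀)).sub (((h2.mul hp₁).mul hq₂).mul hp₂))
      (heqs.mono fun s hs => hs.eq_p₁)
  · exact hθq₂.unique ((((((h2.mul hq₂.sq).mul hp₂).sub hq₂.sq).add (hA.mul hq₂)).sub ht).add
      ((h4.mul ht).mul hp₁) |>.add (((h2.mul hq₁).mul hp₁).mul hq₂))
      (heqs.mono fun s hs => hs.eq_q₂)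
  · exact hθp₂.unique ((((((h2.neg.mul hq₂).mul hp₂.sq).add ((h2.mul hq₂).mul hp₂)).sub
      (hA.mul hp₂)).add (hasLaurentExpansion_const α₁)).sub (((h2.mul hq₁).mul hp₁).mul hp₂))
      (heqs.mono fun s hs => hs.eq_p₂)

theorem mainTheorem3 (α₀ α₁ α₂ α₃ : ℂ) (hα : α₀ + α₁ + 2 * α₂ + α₃ = 1 / 2) :
    ∃ Q₁ P₁ Q₂ P₂ : PowerSeries ℂ,
      -- the first terms of the expansions
      (PowerSeries.coeff 0 Q₁ = -2 * α₀ + α₃ ∧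
        PowerSeries.coeff 0 P₁ = 1 / 4 ∧
        PowerSeries.coeff 1 P₁ = (-2 * α₁ + α₃) * (-2 * α₁ - α₃) / 4 ∧
        PowerSeries.coeff 0 Q₂ = -2 * α₁ + α₃ ∧
        PowerSeries.coeff 0 P₂ = 1 / 4 ∧
        PowerSeries.coeff 1 P₂ = (-2 * α₀ + α₃) * (-2 * α₀ - α₃) / 4) ∧
      -- there is one and only one formal Laurent series solution at infinity
      (∀ q₁ p₁ q₂ p₂ : LaurentSeries ℂ,
        IsFormalSolutionAtInfty α₀ α₁ α₃ q₁ p₁ q₂ p₂ ↔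
          q₁ = HahnSeries.ofPowerSeries ℤ ℂ Q₁ ∧ p₁ = HahnSeries.ofPowerSeries ℤ ℂ P₁ ∧
          q₂ = HahnSeries.ofPowerSeries ℤ ℂ Q₂ ∧ p₂ = HahnSeries.ofPowerSeries ℤ ℂ P₂) ∧
      -- every solution meromorphic at infinity is holomorphic there, with these expansions
      (∀ q₁ p₁ q₂ p₂ : ℂ → ℂ,
        MeromorphicAtInfty q₁ → MeromorphicAtInfty p₁ →
        MeromorphicAtInfty q₂ → MeromorphicAtInfty p₂ →
        IsSolutionNearInfty α₀ α₁ α₃ q₁ p₁ q₂ p₂ →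
          (HolomorphicAtInfty q₁ ∧ HolomorphicAtInfty p₁ ∧
            HolomorphicAtInfty q₂ ∧ HolomorphicAtInfty p₂) ∧
          (HasExpansionAtInfty q₁ Q₁ ∧ HasExpansionAtInfty p₁ P₁ ∧
            HasExpansionAtInfty q₂ Q₂ ∧ HasExpansionAtInfty p₂ P₂)) := by
  obtain ⟨Q₁, P₁, Q₂, P₂, hc, huniq⟩ := exists_isFormalSolutionAtInfty_unique α₀ α₁ α₃
  refine ⟨Q₁, P₁, Q₂, P₂, hc, huniq, ?_⟩
  intro q₁ p₁ q₂ p₂ hq₁ hp₁ hq₂ hp₂ hsol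
  obtain ⟨G₁, hG₁⟩ := MeromorphicAt.exists_hasLaurentExpansion hq₁
  obtain ⟨H₁, hH₁⟩ := MeromorphicAt.exists_hasLaurentExpansion hp₁
  obtain ⟨G₂, hG₂⟩ := MeromorphicAt.exists_hasLaurentExpansion hq₂
  obtain ⟨H₂, hH₂⟩ := MeromorphicAt.exists_hasLaurentExpansion hp₂
  obtain ⟨rfl, rfl, rfl, rfl⟩ :=
    (huniq _ _ _ _).1 (hsol.isFormalSolutionAtInfty hG₁ hH₁ hG₂ hH₂)
  exact ⟨⟨hG₁.holomorphicAtInfty, hH₁.holomorphicAtInfty, hG₂.holomorphicAtInfty,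
    hH₂.holomorphicAtInfty⟩, hG₁.hasExpansionAtInfty, hH₁.hasExpansionAtInfty,
    hG₂.hasExpansionAtInfty, hH₂.hasExpansionAtInfty⟩
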